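/- For $n \ge 2$, let $TVT_n$ (the twisted virtual twin group on $n$ strands) be the group generated by $s_i, \rho_i$ $(1 \le i \le n-1)$ and $\gamma_j$ $(1 \le j \le n)$ subject to the defining relations \begin{align*} s_i^2 &= 1, \quad \rho_i^2 = 1 && (1 \le i \le n-1),\\ s_i s_j &= s_j s_i, \quad \rho_i\rho_j = \rho_j\rho_i, \quad s_i\rho_j = \rho_j s_i && (1 \le i,j \le n-1,\ |i-j| > 1),\\ \rho_i\rho_{i+1}\rho_i &= \rho_{i+1}\rho_i\rho_{i+1}, \quad \rho_i s_{i+1}\rho_i = \rho_{i+1}s_i\rho_{i+1} && (1 \le i \le n-2),\\ \gamma_i^2 &= 1, \quad \gamma_i\gamma_j = \gamma_j\gamma_i && (1 \le i,j \le n),\\ \gamma_j\rho_i &= \rho_i\gamma_j, \quad s_i\gamma_j = \gamma_j s_i && (1 \le i \le n-1,\ 1 \le j \le n,\ j \ne i,i+1),\\ \gamma_{i+1}\rho_i &= \rho_i\gamma_i, \quad \rho_i s_i\rho_i = \gamma_{i+1}\gamma_i s_i\gamma_i\gamma_{i+1} && (1 \le i \le n-1). \end{align*} Let $PTVT_n$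 (the pure twisted virtual twin group) be the kernel of the homomorphism $TVT_n \to S_n$ given by $s_i \mapsto (i,i+1)$, $\rho_i \mapsto (i,i+1)$ and $\gamma_j \mapsto 1$. Then for every $n \ge 2$ the groups $TVT_n$ and $PTVT_n$ are residually finite (the intersection of all normal subgroups of finite index is trivial) and Hopfian (every surjective endomorphism is injective). -/

import Mathlib

/-- The generators `s_i`, `ρ_i` (`1 ≤ i ≤ n - 1`) and `γ_j` (`1 ≤ j ≤ n`), with indices
shifted so as to start from `0`. -/
inductive TVTGen (n : ℕ) : Type
  | s (i : Fin (n - 1)) : TVTGen n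
  | rho (i : Fin (n - 1)) : TVTGen n
  | gamma (j : Fin n) : TVTGen n

namespace TVTGen

/-- The strand `i`, the left one of the two strands `i`, `i + 1` that `s_i` and `ρ_i` involve. -/
def left {n : ℕ} (i : Fin (n - 1)) : Fin n := ⟨i, by have := i.isLt; omega⟩

/-- The strand `i + 1`, the right one of the two strands that `s_i` and `ρ_i` involve. -/
def right {n : ℕ} (i : Fin (n - 1)) : Fin n := ⟨i + 1, by have := i.isLt; omega⟩

/-- The letter `s_i` in the free group. -/
def S {n : ℕ} (i : Fin (n - 1)) : FreeGroup (TVTGen n) := FreeGroup.of (s i)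

/-- The letter `ρ_i` in the free group. -/
def R {n : ℕ} (i : Fin (n - 1)) : FreeGroup (TVTGen n) := FreeGroup.of (rho i)

/-- The letter `γ_j` in the free group. -/
def G {n : ℕ} (j : Fin n) : FreeGroup (TVTGen n) := FreeGroup.of (gamma j)

/-- `Far i j` says that `|i - j| > 1`. -/
def Far {n : ℕ} (i j : Fin (n - 1)) : Prop := 1 < |((i : ℕ) : ℤ) - ((j : ℕ) : ℤ)|

/-- `Rel n u v` says that `u = v` is one of the defining relations of the twisted virtual twin
group on `n` strands. -/
inductive Rel (n : ℕ) : FreeGroup (TVTGen n) → FreeGroup (TVTGen n) → Prop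
  | s_sq (i : Fin (n - 1)) : Rel n (S i ^ 2) 1
  | s_s (i j : Fin (n - 1)) (h : Far i j) : Rel n (S i * S j) (S j * S i)
  | rho_sq (i : Fin (n - 1)) : Rel n (R i ^ 2) 1
  | rho_rho (i j : Fin (n - 1)) (h : Far i j) : Rel n (R i * R j) (R j * R i)
  | rho_braid (i j : Fin (n - 1)) (h : (j : ℕ) = i + 1) :
      Rel n (R i * R j * R i) (R j * R i * R j)
  | s_rho (i j : Fin (n - 1)) (h : Far i j) : Rel n (S i * R j) (R j * S i)
  | rho_s_rho (i j : Fin (n - 1)) (h : (j : ℕ) = i + 1) :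
      Rel n (R i * S j * R i) (R j * S i * R j)
  | gamma_sq (j : Fin n) : Rel n (G j ^ 2) 1
  | gamma_gamma (i j : Fin n) : Rel n (G i * G j) (G j * G i)
  | gamma_rho (i : Fin (n - 1)) (j : Fin n) (h : j ≠ left i) (h' : j ≠ right i) :
      Rel n (G j * R i) (R i * G j)
  | s_gamma (i : Fin (n - 1)) (j : Fin n) (h : j ≠ left i) (h' : j ≠ right i) :
      Rel n (S i * G j) (G j * S i)
  | gamma_slide (i : Fin (n - 1)) : Rel n (G (right i) * R i) (R i * G (left i))
  | twist (i : Fin (n - 1)) :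
      Rel n (R i * S i * R i) (G (right i) * G (left i) * S i * G (left i) * G (right i))

/-- The relators `u v⁻¹` of the defining relations `u = v`. -/
def relators (n : ℕ) : Set (FreeGroup (TVTGen n)) :=
  {r | ∃ u v, Rel n u v ∧ r = u * v⁻¹}

/-- The images of the generators in the symmetric group: `s_i` and `ρ_i` go to the
transposition of the strands `i` and `i + 1`, and `γ_j` goes to the identity. -/
def perm {n : ℕ} : TVTGen n → Equiv.Perm (Fin n)
  | s i => Equiv.swap (left i) (right i)
  | rho i => Equiv.swap (left i) (right i)
  | gamma _ => 1

theorem swap_comm_of_far {n : ℕ} {i j : Fin (n - 1)} (h : Far i j) :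
    Equiv.swap (left i) (right i) * Equiv.swap (left j) (right j) =
      Equiv.swap (left j) (right j) * Equiv.swap (left i) (right i) := by
  have h' : (i : ℕ) + 1 < j ∨ (j : ℕ) + 1 < i := by
    unfold Far at h
    rw [lt_abs] at h
    omega
  apply Equiv.Perm.Disjoint.commute
  apply Equiv.Perm.disjoint_swap_swap
  simp [left, right]
  omega

theorem swap_braid {n : ℕ} {i j : Fin (n - 1)} (h : (j : ℕ) = i + 1) :
    Equiv.swap (left i) (right i) * Equiv.swap (left j) (right j) *
        Equiv.swap (left i) (right i) =
      Equiv.swap (left j) (right j) * Equiv.swap (left i) (right i) *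
        Equiv.swap (left j) (right j) := by
  have e : left j = right i := by simp [left, right, h]
  have h1 : left i ≠ right i := by simp [left, right]
  have h2 : right i ≠ right j := by simp [right, h]
  have h3 : left i ≠ right j := by simp [left, right, h]; omega
  rw [e]
  ext x
  simp only [Equiv.Perm.mul_apply, Equiv.swap_apply_def]
  split_ifs <;> simp_all

theorem lift_perm_eq {n : ℕ} {u v : FreeGroup (TVTGen n)} (h : Rel n u v) :
    FreeGroup.lift perm u = FreeGroup.lift perm v := by
  cases h with
  | s_s i j h => simpa [S, perm] using swap_comm_of_far h
  | rho_rho i j h => simpa [R, perm] using swap_comm_of_far h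
  | s_rho i j h => simpa [S, R, perm] using swap_comm_of_far h
  | rho_braid i j h => simpa [R, perm] using swap_braid h
  | rho_s_rho i j h => simpa [S, R, perm] using swap_braid h
  | _ => simp [S, R, G, perm, pow_two]

theorem lift_perm_relators {n : ℕ} :
    ∀ r ∈ relators n, FreeGroup.lift (perm (n := n)) r = 1 := by
  rintro _ ⟨u, v, h, rfl⟩
  rw [map_mul, map_inv, lift_perm_eq h, mul_inv_cancel]

end TVTGen

/-- The twisted virtual twin group `TVT_n` on `n` strands. -/
abbrev TVT (n : ℕ) : Type := PresentedGroup (TVTGen.relators n)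

/-- The homomorphism `TVT_n → S_n` with `s_i, ρ_i ↦ (i, i + 1)` and `γ_j ↦ 1`. -/
def TVT.toPerm (n : ℕ) : TVT n →* Equiv.Perm (Fin n) :=
  PresentedGroup.toGroup (f := TVTGen.perm) TVTGen.lift_perm_relators

/-- The pure twisted virtual twin group `PTVT_n`. -/
abbrev PTVT (n : ℕ) : Subgroup (TVT n) := (TVT.toPerm n).ker

/-- A group is Hopfian if each of its surjective endomorphisms is injective. -/
def IsHopfianGroup (G : Type*) [Group G] : Prop :=
  ∀ f : G →* G, Function.Surjective f → Function.Injective f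

/-! Write `G` for `TVT n` and `B` for the subgroup generated by the `ρ_i` and `γ_j`. The group `B`
is finite: the `ρ_i` satisfy the Coxeter relations of a symmetric group and normalize the finite
abelian group generated by the `γ_j`. Each remaining relation makes `s_i` an involution, or lets it
commute with some `s_j` or an element of `B`, or equates `B`-conjugates of two of the `s_i`.

Let `W` be the right-angled Coxeter group with one generator per involution of `G`, two of them
commuting when they commute in `G`. `B` acts on `W` by conjugating the indices, and all the
relations hold in `W ⋊ B` because they hold in `G`. The resulting map `G → W ⋊ B` has the evident
map `W ⋊ B → G` as a left inverse, so it is injective (`toGroup_comp_toExtension`). `W` is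
residually finite although it may be infinitely generated
(`RightAngledCoxeterGroup.residuallyFinite`), and the property passes to extensions by a finite
group and to subgroups. Finitely generated residually finite groups are Hopfian by Malcev's
argument, and `PTVT n` has finite index in `G`. -/

/-! ### Residual finiteness: the Hopf property, subgroups, finite extensions. -/

theorem isHopfianGroup_of_residuallyFinite (G : Type*) [Group G] [Group.FG G]
    [Group.ResiduallyFinite G] : IsHopfianGroup G := by
  intro f hf
  rw [injective_iff_map_eq_one]
  intro g hg
  by_contra hne
  obtain ⟨N, hN⟩ := Group.exists_finiteIndexNormalSubgroup_notMem g hne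
  obtain ⟨S, hS, hfin⟩ := Group.fg_iff.mp ‹Group.FG G›
  have : Finite S := hfin
  have : Finite (G ⧸ N.toSubgroup) := Subgroup.finite_quotient_of_finiteIndex
  have : Finite (G →* G ⧸ N.toSubgroup) := by
    refine Finite.of_injective (fun φ (s : S) => φ s) fun φ ψ h => ?_
    exact MonoidHom.eq_of_eqOn_dense hS fun s hs => congrFun h ⟨s, hs⟩
  -- Precomposition with `f` is injective on the finite set of homomorphisms to the quotient, hence
  -- surjective. So the quotient map factors through `f` and kills `g`.
  have hinj : Function.Injective
      (fun φ : G →* G ⧸ N.toSubgroup => φ.comp f) := fun φ ψ h =>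
    (MonoidHom.cancel_right hf).mp h
  obtain ⟨φ, hφ⟩ := Finite.surjective_of_injective hinj (QuotientGroup.mk' N.toSubgroup)
  apply hN
  have := DFunLike.congr_fun hφ g
  simp only [MonoidHom.comp_apply, hg, map_one] at this
  exact (QuotientGroup.eq_one_iff g).mp this.symm

theorem Group.ResiduallyFinite.of_injective {G H : Type*} [Group G] [Group H]
    [Group.ResiduallyFinite H] (f : G →* H) (hf : Function.Injective f) :
    Group.ResiduallyFinite G := by
  rw [Group.residuallyFinite_iff_exists_finiteIndexNormalSubgroup]
  intro g hg
  obtain ⟨L, hL⟩ := Group.exists_finiteIndexNormalSubgroup_notMem (f g) (by simpa using hf.ne hg)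
  exact ⟨L.comap f, hL⟩

/-- A finite-index subgroup of `N` still has finite index in the product. It need not be normal
there, since separation by finite-index subgroups suffices. -/
theorem SemidirectProduct.residuallyFinite {N B : Type*} [Group N] [Group B] [Finite B]
    [Group.ResiduallyFinite N] (φ : B →* MulAut N) : Group.ResiduallyFinite (N ⋊[φ] B) := by
  rw [Group.residuallyFinite_iff_exists_finiteIndex]
  intro g hg
  by_cases hb : g.right = 1
  · have hn : g.left ≠ 1 := fun h => hg (SemidirectProduct.ext h hb)
    obtain ⟨L, hL, hgL⟩ := Group.residuallyFinite_iff_exists_finiteIndex.mp ‹_› g.left hn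
    refine ⟨L.map SemidirectProduct.inl, ⟨?_⟩, ?_⟩
    · rw [Subgroup.index_map, (MonoidHom.ker_eq_bot_iff _).mpr SemidirectProduct.inl_injective,
        sup_bot_eq, SemidirectProduct.range_inl_eq_ker_rightHom]
      exact mul_ne_zero hL.index_ne_zero (Subgroup.finiteIndex_ker _).index_ne_zero
    · rintro ⟨x, hx, rfl⟩
      exact hgL hx
  · exact ⟨SemidirectProduct.rightHom.ker, Subgroup.finiteIndex_ker _, hb⟩

/-! ### Right-angled Coxeter groups -/

/-- The group generated by involutions indexed by `X`, where those related by `C` commute. -/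
abbrev RightAngledCoxeterGroup {X : Type*} (C : X → X → Prop) : Type _ :=
  PresentedGroup {r : FreeGroup X | (∃ x, r = FreeGroup.of x * FreeGroup.of x) ∨
    ∃ x y, C x y ∧ r = FreeGroup.of x * FreeGroup.of y * (FreeGroup.of y * FreeGroup.of x)⁻¹}

namespace RightAngledCoxeterGroup

variable {X : Type*} {C : X → X → Prop}

/-- The generator indexed by `x`. -/
def gen (C : X → X → Prop) (x : X) : RightAngledCoxeterGroup C := PresentedGroup.of x

theorem gen_mul_self (x : X) : gen C x * gen C x = 1 :=
  PresentedGroup.one_of_mem (Or.inl ⟨x, rfl⟩)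

theorem gen_inv (x : X) : (gen C x)⁻¹ = gen C x := inv_eq_of_mul_eq_one_left (gen_mul_self x)

theorem commute_gen {x y : X} (h : C x y) : Commute (gen C x) (gen C y) :=
  PresentedGroup.mk_eq_mk_of_mul_inv_mem (Or.inr ⟨x, y, h, rfl⟩)

/-- The homomorphism that extends a map of the generators to involutions. -/
def lift {H : Type*} [Group H] (f : X → H) (h1 : ∀ x, f x * f x = 1)
    (h2 : ∀ x y, C x y → Commute (f x) (f y)) : RightAngledCoxeterGroup C →* H :=
  PresentedGroup.toGroup (f := f) (by
    rintro _ (⟨x, rfl⟩ | ⟨x, y, h, rfl⟩)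
    · simpa using h1 x
    · simp only [map_mul, map_inv, FreeGroup.lift_apply_of, mul_inv_eq_one]
      exact h2 x y h)

@[simp]
theorem lift_gen {H : Type*} [Group H] (f : X → H) (h1 : ∀ x, f x * f x = 1)
    (h2 : ∀ x y, C x y → Commute (f x) (f y)) (x : X) : lift f h1 h2 (gen C x) = f x :=
  PresentedGroup.toGroup.of _

theorem hom_ext {H : Type*} [Group H] {φ ψ : RightAngledCoxeterGroup C →* H}
    (h : ∀ x, φ (gen C x) = ψ (gen C x)) : φ = ψ :=
  PresentedGroup.ext h

theorem exists_word (g : RightAngledCoxeterGroup C) : ∃ l : List X, (l.map (gen C)).prod = g := by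
  have hg : g ∈ Subgroup.closure (Set.range (gen C)) := by
    have := PresentedGroup.closure_range_of {r : FreeGroup X |
      (∃ x, r = FreeGroup.of x * FreeGroup.of x) ∨
      ∃ x y, C x y ∧ r = FreeGroup.of x * FreeGroup.of y * (FreeGroup.of y * FreeGroup.of x)⁻¹}
    exact this ▸ Subgroup.mem_top g
  induction hg using Subgroup.closure_induction with
  | mem _ h => obtain ⟨x, rfl⟩ := h; exact ⟨[x], by simp⟩
  | one => exact ⟨[], rfl⟩
  | mul _ _ _ _ h1 h2 =>
    obtain ⟨⟨l, rfl⟩, m, rfl⟩ := And.intro h1 h2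
    exact ⟨l ++ m, by simp⟩
  | inv _ _ h =>
    obtain ⟨l, rfl⟩ := h
    refine ⟨l.reverse, ?_⟩
    rw [List.prod_inv_reverse, List.map_reverse, List.map_map]
    congr 2
    exact List.map_congr_left fun x _ => (gen_inv x).symm

/-- A word in which any two occurrences of a letter `x` are separated by a letter that is neither
`x` nor known to commute with `x`. -/
def Reduced (C : X → X → Prop) (l : List X) : Prop :=
  ∀ p q : Fin l.length, p < q → l[p] = l[q] → ∃ r, p < r ∧ r < q ∧ l[r] ≠ l[p] ∧ ¬ C l[p] l[r]

theorem exists_reduced (g : RightAngledCoxeterGroup C) :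
    ∃ l : List X, (l.map (gen C)).prod = g ∧ Reduced C l := by
  classical
  let P : ℕ → Prop := fun k => ∃ l : List X, (l.map (gen C)).prod = g ∧ l.length = k
  have hP : ∃ k, P k := by
    obtain ⟨l, hl⟩ := exists_word g
    exact ⟨_, l, hl, rfl⟩
  obtain ⟨l, hl, hk⟩ := Nat.find_spec hP
  refine ⟨l, hl, fun p q hpq heq => ?_⟩
  by_contra! hcon
  obtain ⟨p, hp⟩ := p
  obtain ⟨q, hq⟩ := q
  simp only [Fin.mk_lt_mk, Fin.getElem_fin] at hpq heq hcon
  obtain ⟨d, rfl⟩ := Nat.exists_eq_add_of_lt hpq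
  set b := (l.drop (p + 1)).take d with hb
  have hsplit : l = l.take p ++ l[p] :: (b ++ l[p] :: l.drop (p + d + 1 + 1)) := by
    conv_lhs => rw [← List.take_append_drop p l, List.drop_eq_getElem_cons hp,
      ← List.take_append_drop d (l.drop (p + 1)), List.drop_drop,
      show p + 1 + d = p + d + 1 by ring, List.drop_eq_getElem_cons hq, ← heq]
  have hcomm : Commute (gen C l[p]) (b.map (gen C)).prod := by
    apply Commute.list_prod_right
    intro y hy
    obtain ⟨z, hz, rfl⟩ := List.mem_map.mp hy
    obtain ⟨i, hi, rfl⟩ := List.mem_iff_getElem.mp hz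
    have hid : i < d := lt_of_lt_of_le hi (by simp [hb])
    have hget : b[i] = l[p + 1 + i] := by simp [hb]
    rw [hget]
    by_cases h : l[p + 1 + i] = l[p]
    · rw [h]
    · exact commute_gen (hcon ⟨p + 1 + i, by omega⟩ (by simp; omega) (by simp; omega) h)
  -- Moving one copy of the letter across `b` to the other cancels both, contradicting minimal
  -- length.
  refine Nat.find_min hP (m := l.length - 2) (by omega)
    ⟨l.take p ++ (b ++ l.drop (p + d + 1 + 1)), ?_, ?_⟩
  · rw [← hl]
    conv_rhs => rw [hsplit]
    simp only [List.map_append, List.map_cons, List.prod_append, List.prod_cons]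
    rw [← mul_assoc (gen C l[p]), hcomm.eq, mul_assoc _ (gen C l[p]), ← mul_assoc (gen C l[p]),
      gen_mul_self, one_mul]
  · simp [hb]
    omega

/-- The positions of the letter `x` in the word `l` that `x` toggles in the set `D`. -/
def togglePositions (C : X → X → Prop) (l : List X) (x : X) (D : Set (Fin l.length)) :
    Set (Fin l.length) :=
  {p | l[p] = x ∧ ∀ r : Fin l.length, l[r] ≠ x → ¬ C x l[r] → (r ∈ D ↔ p < r)}

/-- The test for `x` only looks at positions whose letter is neither `x` nor related to `x`, and `y`
changes none of these. This makes each toggle an involution and makes the toggles of commuting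
generators commute. -/
theorem togglePositions_symmDiff {l : List X} {x y : X} (h : x = y ∨ C x y)
    (D E : Set (Fin l.length)) :
    togglePositions C l x (symmDiff D (togglePositions C l y E)) = togglePositions C l x D := by
  ext p
  refine and_congr_right fun _ => forall_congr' fun r => forall_congr' fun h1 =>
    forall_congr' fun h2 => ?_
  have hr : r ∉ togglePositions C l y E := fun hr => by
    have hy : l[r] = y := hr.1
    rcases h with rfl | h
    · exact h1 hy
    · exact h2 (hy ▸ h)
  simp [Set.mem_symmDiff, hr]

/-- The permutation of the sets of positions of `l` by which the generator `x` acts. -/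
def toggle (C : X → X → Prop) (l : List X) (x : X) : Equiv.Perm (Set (Fin l.length)) :=
  Function.Involutive.toPerm (fun D => symmDiff D (togglePositions C l x D)) fun D => by
    simp [togglePositions_symmDiff (C := C) (Or.inl (rfl : x = x))]

theorem toggle_apply (l : List X) (x : X) (D : Set (Fin l.length)) :
    toggle C l x D = symmDiff D (togglePositions C l x D) := rfl

/-- The action of the group on the sets of positions of a word. -/
def toggleHom (hC : ∀ x y, C x y → C y x) (l : List X) :
    RightAngledCoxeterGroup C →* Equiv.Perm (Set (Fin l.length)) :=
  lift (toggle C l)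
    (fun x => Equiv.ext fun D => by
      simp [toggle_apply, togglePositions_symmDiff (C := C) (Or.inl (rfl : x = x))])
    (fun x y h => Equiv.ext fun D => by
      simp only [Equiv.Perm.mul_apply, toggle_apply, togglePositions_symmDiff (Or.inr h),
        togglePositions_symmDiff (Or.inr (hC x y h)), symmDiff_right_comm])

/-- Read from the right, each letter adds exactly its own position: any other occurrence of it is
separated from that position by a letter on which the toggling test fails. -/
theorem toggleHom_drop (hC : ∀ x y, C x y → C y x) {l : List X} (hl : Reduced C l) {i k : ℕ}
    (hk : i + k = l.length) :
    toggleHom hC l ((l.drop i).map (gen C)).prod ∅ =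
      {p : Fin l.length | i ≤ (p : ℕ)} := by
  induction k generalizing i with
  | zero =>
    have h : l.drop i = [] := by simp; omega
    rw [h]
    ext p
    simp
    omega
  | succ k ih =>
    have hi : i < l.length := by omega
    rw [List.drop_eq_getElem_cons hi, List.map_cons, List.prod_cons, map_mul,
      Equiv.Perm.mul_apply, ih (by omega)]
    have hT : togglePositions C l l[i] {p : Fin l.length | i + 1 ≤ (p : ℕ)} = {⟨i, hi⟩} := by
      ext p
      rw [Set.mem_singleton_iff]
      constructor
      · rintro ⟨hp, h⟩
        rcases lt_trichotomy p ⟨i, hi⟩ with hlt | heq | hgt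
        · obtain ⟨r, hpr, hri, hne, hnc⟩ := hl p ⟨i, hi⟩ hlt hp
          have := (h r (hp ▸ hne) (hp ▸ hnc)).mpr hpr
          simp only [Set.mem_ofPred_eq, Fin.lt_def] at this hri
          omega
        · exact heq
        · obtain ⟨r, hir, hrp, hne, hnc⟩ := hl ⟨i, hi⟩ p hgt hp.symm
          have := (h r hne hnc).mp (by simp only [Set.mem_ofPred_eq, Fin.lt_def] at *; omega)
          exact absurd this hrp.not_gt
      · rintro rfl
        exact ⟨rfl, fun r _ _ => Iff.rfl⟩
    rw [show toggleHom hC l (gen C l[i]) = toggle C l l[i] from lift_gen _ _ _ _, toggle_apply, hT]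
    ext p
    simp only [Set.mem_symmDiff, Set.mem_ofPred_eq, Set.mem_singleton_iff, Fin.ext_iff]
    omega

/-- A reduced word for `g` carries the empty set to the set of all its positions, so `g` acts
nontrivially on a finite set unless the word is empty. -/
theorem residuallyFinite (hC : ∀ x y, C x y → C y x) :
    Group.ResiduallyFinite (RightAngledCoxeterGroup C) := by
  refine Group.residuallyFinite_iff_exists_finiteIndex.mpr fun g hg => ?_
  obtain ⟨l, rfl, hl⟩ := exists_reduced g
  refine ⟨(toggleHom hC l).ker, Subgroup.finiteIndex_ker _, fun h => hg ?_⟩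
  rw [MonoidHom.mem_ker] at h
  have := toggleHom_drop hC hl (zero_add _)
  rw [List.drop_zero, h] at this
  rcases l with _ | ⟨x, l⟩
  · rfl
  · exact absurd this.symm (Set.Nonempty.ne_empty ⟨⟨0, by simp⟩, by simp⟩)

end RightAngledCoxeterGroup

/-! ### Finite groups generated by involutions -/

theorem Subgroup.closure_subset_of_mul_mem {G : Type*} [Group G] {S F : Set G}
    (hS : ∀ s ∈ S, s * s = 1) (h1 : (1 : G) ∈ F) (hF : ∀ x ∈ F, ∀ s ∈ S, x * s ∈ F) :
    (Subgroup.closure S : Set G) ⊆ F := by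
  intro x hx
  induction hx using Subgroup.closure_induction_right with
  | one => exact h1
  | mul_right x _ s hs ih => exact hF x ih s hs
  | mul_inv_cancel x _ s hs ih =>
    rw [inv_eq_of_mul_eq_one_left (hS s hs)]
    exact hF x ih s hs

theorem Subgroup.finite_closure_of_commute {G : Type*} [Group G] {S : Set G} (hfin : S.Finite)
    (hS : ∀ s ∈ S, s * s = 1) (hcomm : ∀ a ∈ S, ∀ b ∈ S, a * b = b * a) :
    (Subgroup.closure S : Set G).Finite := by
  induction S, hfin using Set.Finite.induction_on with
  | empty => simp
  | @insert a T _ _ ih =>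
    have hT := ih (fun s hs => hS s (Or.inr hs)) fun x hx y hy => hcomm x (Or.inr hx) y (Or.inr hy)
    have haT : ∀ x ∈ Subgroup.closure T, a * x = x * a := fun x hx => by
      have : Subgroup.closure T ≤ Subgroup.centralizer {a} := (Subgroup.closure_le _).mpr fun t ht =>
        Subgroup.mem_centralizer_singleton_iff.mpr (hcomm t (Or.inr ht) a (Or.inl rfl))
      exact (Subgroup.mem_centralizer_singleton_iff.mp (this hx)).symm
    refine (hT.union (hT.image (· * a))).subset (Subgroup.closure_subset_of_mul_mem hS
      (Or.inl (one_mem _)) ?_)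
    rintro _ (hx | ⟨x, hx, rfl⟩) s (rfl | hs)
    · exact Or.inr ⟨_, hx, rfl⟩
    · exact Or.inl (mul_mem hx (Subgroup.subset_closure hs))
    · simp only [mul_assoc, hS s (Or.inl rfl), mul_one]
      exact Or.inl hx
    · refine Or.inr ⟨x * s, mul_mem hx (Subgroup.subset_closure hs), ?_⟩
      simp only [mul_assoc, haT s (Subgroup.subset_closure hs)]

section SymmetricPresentation

variable {G : Type*} [Group G]

/-- The product `r m * r (m - 1) * ⋯` of `d` factors. -/
def descendingProd (r : ℕ → G) (m : ℕ) : ℕ → G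
  | 0 => 1
  | d + 1 => descendingProd r m d * r (m - d)

theorem commute_descendingProd {r : ℕ → G} {m : ℕ}
    (comm : ∀ i j, j ≤ m → i + 1 < j → Commute (r i) (r j)) {d j : ℕ} (h : j + d < m) :
    Commute (r j) (descendingProd r m d) := by
  induction d with
  | zero => exact Commute.one_right _
  | succ d ih => exact (ih (by omega)).mul_right (comm _ _ (by omega) (by omega))

/-- The braid relation applies where the product contains `r (j + 1) * r j`; the factors before and
after these two commute with the letter that has to cross them. -/
theorem descendingProd_mul {r : ℕ → G} {m : ℕ}
    (comm : ∀ i j, j ≤ m → i + 1 < j → Commute (r i) (r j))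
    (braid : ∀ i, i + 1 ≤ m → r i * r (i + 1) * r i = r (i + 1) * r i * r (i + 1))
    {d j : ℕ} (hd : d ≤ m + 1) (hj : j + 1 ≤ m) (h : m + 1 ≤ j + d) :
    descendingProd r m d * r (j + 1) = r j * descendingProd r m d := by
  obtain ⟨e, rfl⟩ := Nat.exists_eq_add_of_le (show m + 1 - j ≤ d by omega)
  induction e with
  | zero =>
    obtain ⟨k, rfl⟩ := Nat.exists_eq_add_of_le hj
    have hk : j + 1 + k + 1 - j + 0 = k + 1 + 1 := by omega
    have hc : Commute (r j) (descendingProd r (j + 1 + k) k) :=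
      commute_descendingProd comm (by omega)
    have e1 : j + 1 + k - k = j + 1 := by omega
    have e2 : j + 1 + k - (k + 1) = j := by omega
    rw [hk, descendingProd, descendingProd, e1, e2, mul_assoc, mul_assoc,
      ← mul_assoc (r (j + 1)), ← braid j hj, ← mul_assoc (r j), ← mul_assoc (r j), hc.eq]
    simp only [mul_assoc]
  | succ e ih =>
    rw [← add_assoc, descendingProd, mul_assoc,
      (comm (m - (m + 1 - j + e)) (j + 1) hj (by omega)).eq, ← mul_assoc,
      ih (by omega) (by omega), mul_assoc]

/-- Normal form of the symmetric group: the descending products represent all cosets of the subgroup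
generated by all letters but the last. -/
theorem finite_closure_of_braid (r : ℕ → G) (m : ℕ) (sq : ∀ i < m, r i * r i = 1)
    (comm : ∀ i j, j < m → i + 1 < j → Commute (r i) (r j))
    (braid : ∀ i, i + 1 < m → r i * r (i + 1) * r i = r (i + 1) * r i * r (i + 1)) :
    (Subgroup.closure (r '' Set.Iio m) : Set G).Finite := by
  induction m with
  | zero => simp
  | succ m ih =>
    have hP := ih (fun i hi => sq i (by omega)) (fun i j hj => comm i j (by omega))
      (fun i hi => braid i (by omega))
    set P := Subgroup.closure (r '' Set.Iio m) with hPdef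
    have hmem : ∀ j < m, r j ∈ P := fun j hj => Subgroup.subset_closure ⟨j, hj, rfl⟩
    have comm' : ∀ i j, j ≤ m → i + 1 < j → Commute (r i) (r j) := fun i j hj =>
      comm i j (by omega)
    refine ((hP.mul ((Set.finite_Iic (m + 1)).image (descendingProd r m)))).subset
      (Subgroup.closure_subset_of_mul_mem ?_ ?_ ?_)
    · rintro _ ⟨i, hi, rfl⟩
      exact sq i hi
    · exact ⟨1, one_mem P, 1, ⟨0, by simp, rfl⟩, one_mul 1⟩
    · rintro _ ⟨p, hp, _, ⟨d, hd, rfl⟩, rfl⟩ _ ⟨j, hj, rfl⟩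
      simp only [Set.mem_Iic, Set.mem_Iio] at hd hj
      simp only [mul_assoc]
      -- The last factor of the product is `r (m - d + 1)`. A smaller `j` either commutes into `P`
      -- or, if `j = m - d`, lengthens the product; `j = m - d + 1` cancels that factor; a larger
      -- `j` crosses into `P` as `r (j - 1)`.
      rcases lt_trichotomy (j + d) m with h | h | h
      · rw [← (commute_descendingProd comm' (by omega)).eq, ← mul_assoc]
        exact ⟨_, mul_mem hp (hmem j (by omega)), _, ⟨d, hd, rfl⟩, rfl⟩
      · refine ⟨p, hp, _, ⟨d + 1, by simp; omega, ?_⟩, rfl⟩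
        rw [descendingProd, show m - d = j by omega]
      · rcases Nat.lt_or_ge (m + 1) (j + d) with h' | h'
        · obtain ⟨i, rfl⟩ := Nat.exists_eq_add_of_le' (show 1 ≤ j by omega)
          rw [descendingProd_mul comm' (fun i hi => braid i (by omega)) hd (by omega) (by omega),
            ← mul_assoc]
          exact ⟨_, mul_mem hp (hmem i (by omega)), _, ⟨d, hd, rfl⟩, rfl⟩
        · obtain ⟨e, rfl⟩ := Nat.exists_eq_add_of_le' (show 1 ≤ d by omega)
          refine ⟨p, hp, _, ⟨e, by simp; omega, rfl⟩, ?_⟩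
          simp only [descendingProd]
          rw [show m - e = j by omega, mul_assoc, sq j hj, mul_one]

end SymmetricPresentation

/-! ### The right-angled Coxeter group on the involutions of a group -/

section Involutions

variable {G : Type*} [Group G]

/-- Two involutions of `G` are related if they commute in `G`. -/
def InvolutionsCommute (x y : {g : G // g * g = 1}) : Prop := Commute x.1 y.1

/-- Conjugation by `b` as a map on the involutions of `G`. -/
def conjInvolution (b : G) (x : {g : G // g * g = 1}) : {g : G // g * g = 1} :=
  ⟨MulAut.conj b x.1, by rw [← map_mul, x.2, map_one]⟩

open RightAngledCoxeterGroup

/-- The endomorphism of the right-angled Coxeter group on the involutions of `G` that conjugation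
by `b` induces. -/
def conjInvolutionHom (b : G) : RightAngledCoxeterGroup (InvolutionsCommute (G := G)) →*
    RightAngledCoxeterGroup (InvolutionsCommute (G := G)) :=
  lift (fun x => gen _ (conjInvolution b x)) (fun _ => gen_mul_self _)
    (fun _ _ h => commute_gen (h.map (MulAut.conj b)))

theorem conjInvolutionHom_one : conjInvolutionHom (1 : G) = MonoidHom.id _ :=
  hom_ext fun x => by simp [conjInvolutionHom, conjInvolution]

theorem conjInvolutionHom_mul (b c : G) :
    conjInvolutionHom (b * c) = (conjInvolutionHom b).comp (conjInvolutionHom c) :=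
  hom_ext fun x => by simp [conjInvolutionHom, conjInvolution]

/-- The action of `G` by conjugation on the right-angled Coxeter group on its involutions. -/
def conjInvolutionAut :
    G →* MulAut (RightAngledCoxeterGroup (InvolutionsCommute (G := G))) where
  toFun b := MonoidHom.toMulEquiv (conjInvolutionHom b) (conjInvolutionHom b⁻¹)
    (by rw [← conjInvolutionHom_mul, inv_mul_cancel, conjInvolutionHom_one])
    (by rw [← conjInvolutionHom_mul, mul_inv_cancel, conjInvolutionHom_one])
  map_one' := MulEquiv.ext fun x => DFunLike.congr_fun conjInvolutionHom_one x
  map_mul' b c := MulEquiv.ext fun x => DFunLike.congr_fun (conjInvolutionHom_mul b c) x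

theorem conjInvolutionAut_gen (b : G) (x : {g : G // g * g = 1}) :
    conjInvolutionAut b (gen _ x) = gen _ (conjInvolution b x) := by
  change conjInvolutionHom b (gen _ x) = _
  exact lift_gen _ _ _ x

/-- The semidirect product of the right-angled Coxeter group on the involutions of `G` by a
subgroup of `G`. -/
abbrev InvolutionExtension (B : Subgroup G) : Type _ :=
  RightAngledCoxeterGroup (InvolutionsCommute (G := G)) ⋊[conjInvolutionAut.comp B.subtype] B

namespace InvolutionExtension

variable (B : Subgroup G)

/-- The element given by an involution of `G`. -/
def ofInvolution (x : {g : G // g * g = 1}) : InvolutionExtension B :=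
  SemidirectProduct.inl (gen _ x)

/-- The tautological homomorphism to `G`. -/
def toGroup : InvolutionExtension B →* G :=
  SemidirectProduct.lift (lift Subtype.val (fun x => x.2) fun _ _ h => h) B.subtype fun b =>
    hom_ext fun x => by
      simp only [MonoidHom.comp_apply, MulEquiv.coe_toMonoidHom, Subgroup.subtype_apply,
        conjInvolutionAut_gen]
      erw [lift_gen, lift_gen]
      rfl

@[simp]
theorem toGroup_ofInvolution (x : {g : G // g * g = 1}) : toGroup B (ofInvolution B x) = x.1 := by
  rw [toGroup, ofInvolution, SemidirectProduct.lift_inl]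
  exact lift_gen _ _ _ x

@[simp]
theorem toGroup_inr (b : B) : toGroup B (SemidirectProduct.inr b) = b := by
  simp [toGroup]

variable {B}

theorem ofInvolution_mul_self (x : {g : G // g * g = 1}) :
    ofInvolution B x * ofInvolution B x = 1 := by
  rw [ofInvolution, ← map_mul, gen_mul_self, map_one]

theorem ofInvolution_commute {x y : {g : G // g * g = 1}} (h : x.1 * y.1 = y.1 * x.1) :
    ofInvolution B x * ofInvolution B y = ofInvolution B y * ofInvolution B x :=
  (commute_gen (C := InvolutionsCommute) h).map SemidirectProduct.inl

theorem inr_mul_ofInvolution (b : B) (x : {g : G // g * g = 1}) :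
    SemidirectProduct.inr b * ofInvolution B x =
      ofInvolution B (conjInvolution b x) * SemidirectProduct.inr b := by
  rw [ofInvolution, ofInvolution, ← conjInvolutionAut_gen, ← Subgroup.subtype_apply,
    ← MonoidHom.comp_apply, SemidirectProduct.inl_aut, map_inv, inv_mul_cancel_right]

/-- Generators are indexed by actual elements of `G`, so conjugates that agree in `G` are the same
generator. -/
theorem conj_eq_conj {x y : {g : G // g * g = 1}} {b b' c c' : B} (hb : b * b' = 1)
    (hc : c * c' = 1) (h : (b : G) * x * b' = c * y * c') :
    SemidirectProduct.inr b * ofInvolution B x * SemidirectProduct.inr b' =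
      SemidirectProduct.inr c * ofInvolution B y * SemidirectProduct.inr c' := by
  obtain rfl := eq_inv_of_mul_eq_one_right hb
  obtain rfl := eq_inv_of_mul_eq_one_right hc
  have : conjInvolution (b : G) x = conjInvolution (c : G) y := Subtype.ext h
  simp only [inr_mul_ofInvolution, map_inv, mul_inv_cancel_right, this]

theorem commute_inr {x : {g : G // g * g = 1}} {b : B} (h : (x : G) * b = b * x) :
    ofInvolution B x * SemidirectProduct.inr b = SemidirectProduct.inr b * ofInvolution B x := by
  rw [inr_mul_ofInvolution]
  congr 2
  exact Subtype.ext (eq_mul_inv_of_mul_eq h)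

end InvolutionExtension

end Involutions
-- The twisted virtual twin group
namespace TVT

open TVTGen

variable {n : ℕ}

theorem mk_eq_mk {u v : FreeGroup (TVTGen n)} (h : Rel n u v) :
    PresentedGroup.mk (relators n) u = PresentedGroup.mk (relators n) v :=
  PresentedGroup.mk_eq_mk_of_mul_inv_mem ⟨u, v, h, rfl⟩

/-- The generator `s_i`. -/
def s (i : Fin (n - 1)) : TVT n := PresentedGroup.of (TVTGen.s i)

/-- The generator `ρ_i`. -/
def rho (i : Fin (n - 1)) : TVT n := PresentedGroup.of (TVTGen.rho i)

/-- The generator `γ_j`. -/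
def gamma (j : Fin n) : TVT n := PresentedGroup.of (TVTGen.gamma j)

theorem s_mul_self (i : Fin (n - 1)) : s i * s i = 1 :=
  (pow_two (s i)).symm.trans (mk_eq_mk (Rel.s_sq i))

theorem rho_mul_self (i : Fin (n - 1)) : rho i * rho i = 1 :=
  (pow_two (rho i)).symm.trans (mk_eq_mk (Rel.rho_sq i))

theorem gamma_mul_self (j : Fin n) : gamma j * gamma j = 1 :=
  (pow_two (gamma j)).symm.trans (mk_eq_mk (Rel.gamma_sq j))

theorem rho_inv (i : Fin (n - 1)) : (rho i)⁻¹ = rho i :=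
  inv_eq_of_mul_eq_one_left (rho_mul_self i)

theorem gamma_comm (i j : Fin n) : gamma i * gamma j = gamma j * gamma i :=
  mk_eq_mk (Rel.gamma_gamma i j)

theorem gamma_right_mul_rho (i : Fin (n - 1)) :
    gamma (right i) * rho i = rho i * gamma (left i) :=
  mk_eq_mk (Rel.gamma_slide i)

theorem rho_conj_gamma (i : Fin (n - 1)) (j : Fin n) :
    ∃ k, rho i * gamma j * (rho i)⁻¹ = gamma k := by
  by_cases hl : j = left i
  · exact ⟨right i, by rw [hl, ← gamma_right_mul_rho, mul_inv_cancel_right]⟩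
  by_cases hr : j = right i
  · refine ⟨left i, ?_⟩
    rw [hr, mul_assoc, rho_inv, gamma_right_mul_rho, ← mul_assoc, rho_mul_self, one_mul]
  · exact ⟨j, by rw [← (show gamma j * rho i = rho i * gamma j from
      mk_eq_mk (Rel.gamma_rho i j hl hr)), mul_inv_cancel_right]⟩

theorem finite_closure_rho : (Subgroup.closure (Set.range (rho (n := n))) : Set (TVT n)).Finite := by
  let r : ℕ → TVT n := fun i => if h : i < n - 1 then rho ⟨i, h⟩ else 1
  have hr : ∀ {i : ℕ} (h : i < n - 1), r i = rho ⟨i, h⟩ := fun h => dif_pos h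
  have hrange : Set.range (rho (n := n)) = r '' Set.Iio (n - 1) := by
    ext g
    constructor
    · rintro ⟨i, rfl⟩
      exact ⟨i, i.isLt, hr i.isLt⟩
    · rintro ⟨i, hi, rfl⟩
      exact ⟨⟨i, hi⟩, (hr hi).symm⟩
  rw [hrange]
  refine finite_closure_of_braid r (n - 1) (fun i hi => ?_) (fun i j hj hij => ?_) fun i hi => ?_
  · rw [hr hi, rho_mul_self]
  · have hi : i < n - 1 := by omega
    rw [hr hi, hr hj]
    exact mk_eq_mk (Rel.rho_rho _ _ (by simp only [Far, lt_abs]; omega))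
  · have hi' : i < n - 1 := by omega
    rw [hr hi, hr hi']
    exact mk_eq_mk (Rel.rho_braid _ _ rfl)

/-- The subgroup generated by the `ρ_i` and the `γ_j`. -/
def virtualSubgroup (n : ℕ) : Subgroup (TVT n) :=
  Subgroup.closure (Set.range rho) ⊔ Subgroup.closure (Set.range gamma)

instance : Finite (virtualSubgroup n) := by
  have hle : Subgroup.closure (Set.range (rho (n := n))) ≤
      Subgroup.normalizer (Subgroup.closure (Set.range (gamma (n := n))) : Set (TVT n)) := by
    have hconj : ∀ i : Fin (n - 1), ∀ g ∈ Subgroup.closure (Set.range (gamma (n := n))),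
        rho i * g * (rho i)⁻¹ ∈ Subgroup.closure (Set.range (gamma (n := n))) := by
      intro i
      suffices h : Subgroup.closure (Set.range (gamma (n := n))) ≤
          (Subgroup.closure (Set.range gamma)).comap (MulAut.conj (rho i)).toMonoidHom from
        fun g hg => h hg
      rw [Subgroup.closure_le]
      rintro _ ⟨j, rfl⟩
      obtain ⟨k, hk⟩ := rho_conj_gamma i j
      exact Subgroup.subset_closure ⟨k, hk.symm⟩
    rw [Subgroup.closure_le]
    rintro _ ⟨i, rfl⟩
    refine Subgroup.mem_normalizer_iff.mpr fun g => ⟨hconj i g, fun hg => ?_⟩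
    have := hconj i _ hg
    simpa only [rho_inv, mul_assoc, rho_mul_self, mul_one, ← mul_assoc (rho i) (rho i),
      one_mul] using this
  refine Set.Finite.to_subtype (?_ : (virtualSubgroup n : Set (TVT n)).Finite)
  rw [virtualSubgroup, Subgroup.coe_mul_of_left_le_normalizer_right _ _ hle]
  refine finite_closure_rho.mul (Subgroup.finite_closure_of_commute (Set.finite_range _) ?_ ?_)
  · rintro _ ⟨j, rfl⟩
    exact gamma_mul_self j
  · rintro _ ⟨i, rfl⟩ _ ⟨j, rfl⟩
    exact gamma_comm i j

/-- `s_i` as an involution. -/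
def sInvolution (i : Fin (n - 1)) : {g : TVT n // g * g = 1} := ⟨s i, s_mul_self i⟩

/-- `ρ_i` as an element of the virtual subgroup. -/
def rhoVirtual (i : Fin (n - 1)) : virtualSubgroup n :=
  ⟨rho i, Subgroup.mem_sup_left (Subgroup.subset_closure ⟨i, rfl⟩)⟩

/-- `γ_j` as an element of the virtual subgroup. -/
def gammaVirtual (j : Fin n) : virtualSubgroup n :=
  ⟨gamma j, Subgroup.mem_sup_right (Subgroup.subset_closure ⟨j, rfl⟩)⟩

theorem rhoVirtual_mul_self (i : Fin (n - 1)) : rhoVirtual i * rhoVirtual i = 1 :=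
  Subtype.ext (rho_mul_self i)

theorem gammaVirtual_mul_self (j : Fin n) : gammaVirtual j * gammaVirtual j = 1 :=
  Subtype.ext (gamma_mul_self j)

/-- The images of the generators in the extension of the virtual subgroup. -/
def toExtensionGen : TVTGen n → InvolutionExtension (virtualSubgroup n)
  | .s i => InvolutionExtension.ofInvolution _ (sInvolution i)
  | .rho i => SemidirectProduct.inr (rhoVirtual i)
  | .gamma j => SemidirectProduct.inr (gammaVirtual j)

open InvolutionExtension in
theorem lift_toExtensionGen_eq {u v : FreeGroup (TVTGen n)} (h : Rel n u v) :
    FreeGroup.lift toExtensionGen u = FreeGroup.lift toExtensionGen v := by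
  have hG := mk_eq_mk h
  cases h with
  | s_sq i => simpa [S, toExtensionGen, pow_two] using ofInvolution_mul_self _
  | s_s i j h =>
    simp only [S, toExtensionGen, map_mul, FreeGroup.lift_apply_of]
    exact ofInvolution_commute hG
  | s_rho i j h =>
    simp only [S, R, toExtensionGen, map_mul, FreeGroup.lift_apply_of]
    exact commute_inr hG
  | s_gamma i j h h' =>
    simp only [S, G, toExtensionGen, map_mul, FreeGroup.lift_apply_of]
    exact commute_inr hG
  | rho_s_rho i j h =>
    simp only [S, R, toExtensionGen, map_mul, FreeGroup.lift_apply_of]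
    exact conj_eq_conj (rhoVirtual_mul_self i) (rhoVirtual_mul_self j) hG
  | twist i =>
    simp only [S, R, G, toExtensionGen, map_mul, FreeGroup.lift_apply_of]
    -- Regrouped as `c * s_i * c'` with `c = γ_{i+1} γ_i` and `c' = γ_i γ_{i+1}`, which are mutually
    -- inverse.
    rw [mul_assoc _ (SemidirectProduct.inr (gammaVirtual (left i))), ← map_mul, ← map_mul]
    refine conj_eq_conj (rhoVirtual_mul_self i) ?_ ?_
    · rw [mul_assoc, ← mul_assoc (gammaVirtual (left i)), gammaVirtual_mul_self, one_mul,
        gammaVirtual_mul_self]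
    · refine hG.trans ?_
      simp only [map_mul, Subgroup.coe_mul, ← mul_assoc]
      rfl
  -- The remaining relations involve only the `ρ_i` and `γ_j`, so they hold in the virtual subgroup.
  | _ =>
    simp only [R, G, toExtensionGen, map_mul, map_pow, map_one, FreeGroup.lift_apply_of]
    simp only [← map_mul, ← map_pow, ← map_one (SemidirectProduct.inr (N := RightAngledCoxeterGroup
      (InvolutionsCommute (G := TVT n))) (φ := conjInvolutionAut.comp (virtualSubgroup n).subtype))]
    exact congrArg _ (Subtype.ext hG)

/-- The embedding of `TVT n` into the extension of its virtual subgroup. -/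
def toExtension (n : ℕ) : TVT n →* InvolutionExtension (virtualSubgroup n) :=
  PresentedGroup.toGroup (f := toExtensionGen) (by
    rintro _ ⟨u, v, h, rfl⟩
    rw [map_mul, map_inv, lift_toExtensionGen_eq h, mul_inv_cancel])

theorem toGroup_comp_toExtension (n : ℕ) :
    (InvolutionExtension.toGroup (virtualSubgroup n)).comp (toExtension n) = MonoidHom.id _ := by
  refine PresentedGroup.ext fun x => ?_
  rw [MonoidHom.comp_apply, toExtension, PresentedGroup.toGroup.of]
  cases x
  · exact InvolutionExtension.toGroup_ofInvolution _ _
  · exact InvolutionExtension.toGroup_inr _ _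
  · exact InvolutionExtension.toGroup_inr _ _

instance residuallyFinite (n : ℕ) : Group.ResiduallyFinite (TVT n) := by
  have := RightAngledCoxeterGroup.residuallyFinite (C := InvolutionsCommute (G := TVT n))
    fun _ _ h => h.symm
  have : Group.ResiduallyFinite (InvolutionExtension (virtualSubgroup n)) :=
    SemidirectProduct.residuallyFinite _
  refine Group.ResiduallyFinite.of_injective (toExtension n) ?_
  exact Function.LeftInverse.injective (g := InvolutionExtension.toGroup (virtualSubgroup n))
    (DFunLike.congr_fun (toGroup_comp_toExtension n))

instance fg (n : ℕ) : Group.FG (TVT n) := by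
  have : Finite (TVTGen n) := by
    let f : TVTGen n → (Fin (n - 1) ⊕ Fin (n - 1)) ⊕ Fin n := fun
      | .s i => .inl (.inl i)
      | .rho i => .inl (.inr i)
      | .gamma j => .inr j
    refine Finite.of_injective f ?_
    rintro (_ | _ | _) (_ | _ | _) h <;> simp_all [f]
  exact Group.fg_iff.mpr ⟨_, PresentedGroup.closure_range_of _, Set.finite_range _⟩

end TVT

theorem mainTheorem8 (n : ℕ) (hn : 2 ≤ n) :
    (Group.ResiduallyFinite (TVT n) ∧ IsHopfianGroup (TVT n)) ∧
      (Group.ResiduallyFinite (PTVT n) ∧ IsHopfianGroup (PTVT n)) := by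
  have : (PTVT n).FiniteIndex := Subgroup.finiteIndex_ker _
  have : Group.FG (PTVT n) := Subgroup.fg_of_index_ne_zero _
  exact ⟨⟨inferInstance, isHopfianGroup_of_residuallyFinite _⟩,
    inferInstance, isHopfianGroup_of_residuallyFinite _⟩
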